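/- There are universal constants $C,c>0$ such that the following holds. Let $\mathbb K$ be $\mathbb R$ or $\mathbb C$, let $A,E\in\mathbb K^{m\times n}$ with $A\neq 0$, let $k=\operatorname{rank}(A)$, let $r=\|A\|_F^2/\|A\|_2^2$ be the stable rank of $A$, and let $\kappa(A)=\sigma_{\max}(A)/\sigma_{\min}(A)$, where $\sigma_{\min}(A)$ is the least nonzero singular value. Put $\widetilde A=A+E$ and suppose that no row or column of $\widetilde A$ is $0$ unless the corresponding row or column of $A$ is $0$. Let $$\widetilde q_i=\frac{\|\widetilde A(i,:)\|_2^2}{\|\widetilde A\|_F^2},\qquad \widetilde p_j=\frac{\|\widetilde A(:,j)\|_2^2}{\|\widetilde A\|_F^2},$$ $$\beta_i=\left|\frac{1-\|E(i,:)\|_2/\|A(i,:)\|_2}{1+\|E\|_F/\|A\|_F}\right|,\qquad \alpha_j=\left|\frac{1-\|E(:,j)\|_2/\|A(:,j)\|_2}{1+\|E\|_F/\|A\|_F}\right|,$$ where $\beta_i:=1$ if $A(i,:)=0$ and $\alpha_j:=1$ if $A(:,j)=0$. Set $\alpha=\min_j\alpha_j$, $\beta=\min_i\beta_i$ and $\gamma=\min\{\alpha,\beta\}$.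 Let $\delta\in(0,1)$ and $0<\varepsilon<\min\{\kappa(A)^{-1},\,\delta^{-1/4}\sqrt{2\gamma}\}$ (in particular $\gamma>0$), and let $d_1,d_2$ be natural numbers with $$d_1,\,d_2\ \ge\ C\,\frac{r}{\varepsilon^4\delta}\log\left(\frac{r}{\varepsilon^4\delta}\right).$$ Draw $d_1$ row indices $I$ with probabilities $\widetilde q_i$ and $d_2$ column indices $J$ with probabilities $\widetilde p_j$, all independently and with replacement, and set $C_J=A(:,J)$, $U=A(I,J)$, $R=A(I,:)$. Then, with probability at least $$\max\left\{0,\,1-2\exp\left(-\frac{c\,\alpha^2}{\delta}\right)\right\}\cdot\max\left\{0,\,1-2\exp\left(-\frac{c\,\beta^2}{\delta}\right)\right\},$$ $$\operatorname{rank}(U)=k\quad\text{and}\quad A=C_JU^\dagger R$$ ($U^\dagger$ is the Moore–Penrose pseudoinverse), and the same two identities hold when $I$ and $J$ are replaced by the sets of their distinct entries. -/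

import Mathlib

namespace CUR

open MeasureTheory
open scoped Matrix

/-! ### The Moore-Penrose pseudoinverse -/

/-- `X` satisfies the four Penrose equations for `M`. -/
structure IsMoorePenrose {𝕜 ι κ : Type*} [RCLike 𝕜] [Fintype ι] [Fintype κ]
    (M : Matrix ι κ 𝕜) (X : Matrix κ ι 𝕜) : Prop where
  mul_mul_self : M * X * M = M
  mul_mul_inv : X * M * X = X
  isHermitian_mul : (M * X).IsHermitian
  isHermitian_mul' : (X * M).IsHermitian

theorem exists_isMoorePenrose {𝕜 ι κ : Type*} [RCLike 𝕜] [Fintype ι] [Fintype κ]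
    (M : Matrix ι κ 𝕜) : ∃ X : Matrix κ ι 𝕜, IsMoorePenrose M X := by
  classical
  have hH : (Mᴴ * M).IsHermitian := Matrix.isHermitian_conjTranspose_mul_self M
  obtain ⟨B, hB, hBH, hHBH, hBHB⟩ : ∃ B : Matrix κ κ 𝕜, B.IsHermitian ∧
      (B * (Mᴴ * M)).IsHermitian ∧ Mᴴ * M * B * (Mᴴ * M) = Mᴴ * M ∧
      B * (Mᴴ * M) * B = B := by
    obtain ⟨U, hU, hU', D, hD⟩ : ∃ U : Matrix κ κ 𝕜, Uᴴ * U = 1 ∧ U * Uᴴ = 1 ∧ ∃ D : κ → ℝ,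
        Mᴴ * M = U * Matrix.diagonal (fun i => (D i : 𝕜)) * Uᴴ := by
      refine ⟨hH.eigenvectorUnitary, ?_, ?_, hH.eigenvalues, ?_⟩
      · exact Unitary.coe_star_mul_self hH.eigenvectorUnitary
      · exact Unitary.coe_mul_star_self hH.eigenvectorUnitary
      · exact hH.spectral_theorem
    have key : ∀ a b : κ → 𝕜, (U * Matrix.diagonal a * Uᴴ) * (U * Matrix.diagonal b * Uᴴ) =
        U * Matrix.diagonal (fun i => a i * b i) * Uᴴ := by
      intro a b
      calc _ = U * Matrix.diagonal a * (Uᴴ * U) * Matrix.diagonal b * Uᴴ := by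
            simp only [Matrix.mul_assoc]
        _ = _ := by
            rw [hU, Matrix.mul_one, Matrix.mul_assoc U, Matrix.diagonal_mul_diagonal]
    have herm : ∀ a : κ → ℝ, (U * Matrix.diagonal (fun i => (a i : 𝕜)) * Uᴴ).IsHermitian := by
      intro a
      apply Matrix.isHermitian_mul_mul_conjTranspose
      refine Matrix.isHermitian_diagonal_of_self_adjoint _ ?_
      ext i
      simp
    refine ⟨U * Matrix.diagonal (fun i => ((D i)⁻¹ : 𝕜)) * Uᴴ, ?_, ?_, ?_, ?_⟩
    · simpa using herm (fun i => (D i)⁻¹)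
    · rw [hD, key]
      simpa using herm (fun i => (D i)⁻¹ * D i)
    · rw [hD, key, key]
      simp
    · rw [hD, key, key]
      congr 3
      funext i
      by_cases h : (D i : 𝕜) = 0 <;> simp [h]
  refine ⟨B * Mᴴ, ?_, ?_, ?_, ?_⟩
  · have h : Mᴴ * M * (B * (Mᴴ * M) - 1) = 0 := by
      rw [Matrix.mul_sub, ← Matrix.mul_assoc, hHBH, Matrix.mul_one, sub_self]
    open scoped ComplexOrder in
    rw [Matrix.conjTranspose_mul_self_mul_eq_zero, Matrix.mul_sub, Matrix.mul_one,
      sub_eq_zero] at h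
    simpa only [Matrix.mul_assoc] using h
  · calc B * Mᴴ * M * (B * Mᴴ) = B * (Mᴴ * M) * B * Mᴴ := by simp only [Matrix.mul_assoc]
      _ = B * Mᴴ := by rw [hBHB]
  · rw [← Matrix.mul_assoc]
    exact Matrix.isHermitian_mul_mul_conjTranspose _ hB
  · rw [Matrix.mul_assoc]
    exact hBH

/-- The Moore-Penrose pseudoinverse `M†`. -/
noncomputable def pinv {𝕜 ι κ : Type*} [RCLike 𝕜] [Fintype ι] [Fintype κ]
    (M : Matrix ι κ 𝕜) : Matrix κ ι 𝕜 :=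
  (exists_isMoorePenrose M).choose

theorem isMoorePenrose_pinv {𝕜 ι κ : Type*} [RCLike 𝕜] [Fintype ι] [Fintype κ]
    (M : Matrix ι κ 𝕜) : IsMoorePenrose M (pinv M) :=
  (exists_isMoorePenrose M).choose_spec

/-- The Penrose equations determine the pseudoinverse. -/
theorem IsMoorePenrose.eq_pinv {𝕜 ι κ : Type*} [RCLike 𝕜] [Fintype ι] [Fintype κ]
    {M : Matrix ι κ 𝕜} {X : Matrix κ ι 𝕜} (hX : IsMoorePenrose M X) : X = pinv M := by
  have hY := isMoorePenrose_pinv M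
  set Y := pinv M
  have h1 : M * X = M * Y := by
    calc M * X = (M * X)ᴴ := hX.isHermitian_mul.symm
      _ = ((M * Y) * (M * X))ᴴ := by rw [← Matrix.mul_assoc, hY.mul_mul_self]
      _ = (M * X) * (M * Y) := by
        rw [Matrix.conjTranspose_mul, hX.isHermitian_mul.eq, hY.isHermitian_mul.eq]
      _ = M * Y := by rw [← Matrix.mul_assoc, hX.mul_mul_self]
  have h2 : X * M = Y * M := by
    calc X * M = (X * M)ᴴ := hX.isHermitian_mul'.symm
      _ = ((X * M) * (Y * M))ᴴ := by
        rw [Matrix.mul_assoc, ← Matrix.mul_assoc M, hY.mul_mul_self]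
      _ = (Y * M) * (X * M) := by
        rw [Matrix.conjTranspose_mul, hX.isHermitian_mul'.eq, hY.isHermitian_mul'.eq]
      _ = Y * M := by rw [Matrix.mul_assoc, ← Matrix.mul_assoc M, hX.mul_mul_self]
  calc X = X * M * X := hX.mul_mul_inv.symm
    _ = Y * M * Y := by rw [h2, Matrix.mul_assoc, h1, ← Matrix.mul_assoc]
    _ = Y := hY.mul_mul_inv

/-! ### Norms, stable rank and condition number -/

/-- The Euclidean norm of the row `A(i,:)`. -/
noncomputable def rowNorm {𝕜 : Type*} [RCLike 𝕜] {m n : ℕ} (A : Matrix (Fin m) (Fin n) 𝕜)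
    (i : Fin m) : ℝ :=
  √(∑ j, ‖A i j‖ ^ 2)

/-- The Euclidean norm of the column `A(:,j)`. -/
noncomputable def colNorm {𝕜 : Type*} [RCLike 𝕜] {m n : ℕ} (A : Matrix (Fin m) (Fin n) 𝕜)
    (j : Fin n) : ℝ :=
  √(∑ i, ‖A i j‖ ^ 2)

/-- The Frobenius norm. -/
noncomputable def frobNorm {𝕜 : Type*} [RCLike 𝕜] {m n : ℕ}
    (A : Matrix (Fin m) (Fin n) 𝕜) : ℝ :=
  √(∑ i, ∑ j, ‖A i j‖ ^ 2)

/-- The spectral norm `‖A‖₂`: the operator norm between Euclidean spaces. -/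
noncomputable def specNorm {𝕜 : Type*} [RCLike 𝕜] {m n : ℕ}
    (A : Matrix (Fin m) (Fin n) 𝕜) : ℝ :=
  ‖(Matrix.toEuclideanLin A).toContinuousLinearMap‖

/-- The stable rank `‖A‖_F² / ‖A‖₂²` (meaningful for `A ≠ 0`). -/
noncomputable def stableRank {𝕜 : Type*} [RCLike 𝕜] {m n : ℕ}
    (A : Matrix (Fin m) (Fin n) 𝕜) : ℝ :=
  frobNorm A ^ 2 / specNorm A ^ 2

/-- The condition number `κ(A) = σ_max(A) / σ_min(A)`, where `σ_min` is the least nonzero singular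
value (meaningful for `A ≠ 0`). Mathlib lists singular values in decreasing order from index `0`,
so the least nonzero one has index `rank A - 1`. -/
noncomputable def condNumber {𝕜 : Type*} [RCLike 𝕜] {m n : ℕ}
    (A : Matrix (Fin m) (Fin n) 𝕜) : ℝ :=
  (Matrix.toEuclideanLin A).singularValues 0 /
    (Matrix.toEuclideanLin A).singularValues (A.rank - 1)

/-! ### Sampling by squared lengths -/

/-- The law `q_i = ‖M(i,:)‖₂² / ‖M‖_F²` on row indices. -/
noncomputable def rowLaw {𝕜 : Type*} [RCLike 𝕜] {m n : ℕ} (M : Matrix (Fin m) (Fin n) 𝕜) :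
    Measure (Fin m) :=
  ∑ i, ENNReal.ofReal (rowNorm M i ^ 2 / frobNorm M ^ 2) • Measure.dirac i

/-- The law `p_j = ‖M(:,j)‖₂² / ‖M‖_F²` on column indices. -/
noncomputable def colLaw {𝕜 : Type*} [RCLike 𝕜] {m n : ℕ} (M : Matrix (Fin m) (Fin n) 𝕜) :
    Measure (Fin n) :=
  ∑ j, ENNReal.ofReal (colNorm M j ^ 2 / frobNorm M ^ 2) • Measure.dirac j

theorem frobNorm_sq_pos {𝕜 : Type*} [RCLike 𝕜] {m n : ℕ} {M : Matrix (Fin m) (Fin n) 𝕜}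
    (hM : M ≠ 0) : 0 < ∑ i, ∑ j, ‖M i j‖ ^ 2 := by
  obtain ⟨i, j, hij⟩ : ∃ i j, M i j ≠ 0 := by
    by_contra! h
    exact hM (Matrix.ext h)
  refine Finset.sum_pos' (fun i _ => by positivity) ⟨i, Finset.mem_univ i, ?_⟩
  exact Finset.sum_pos' (fun j _ => by positivity) ⟨j, Finset.mem_univ j, by positivity⟩

theorem isProbabilityMeasure_rowLaw {𝕜 : Type*} [RCLike 𝕜] {m n : ℕ}
    {M : Matrix (Fin m) (Fin n) 𝕜} (hM : M ≠ 0) : IsProbabilityMeasure (rowLaw M) := by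
  refine ⟨?_⟩
  have h := frobNorm_sq_pos hM
  simp only [rowLaw, Measure.coe_finsetSum, Finset.sum_apply, Measure.smul_apply,
    measure_univ, smul_eq_mul, mul_one]
  rw [← ENNReal.ofReal_sum_of_nonneg (fun i _ => by positivity), ← Finset.sum_div]
  simp only [rowNorm, frobNorm]
  rw [Real.sq_sqrt h.le]
  have h2 : ∀ i, √(∑ j, ‖M i j‖ ^ 2) ^ 2 = ∑ j, ‖M i j‖ ^ 2 := fun i =>
    Real.sq_sqrt (Finset.sum_nonneg fun j _ => sq_nonneg _)
  simp only [h2]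
  rw [div_self h.ne', ENNReal.ofReal_one]

theorem isProbabilityMeasure_colLaw {𝕜 : Type*} [RCLike 𝕜] {m n : ℕ}
    {M : Matrix (Fin m) (Fin n) 𝕜} (hM : M ≠ 0) : IsProbabilityMeasure (colLaw M) := by
  refine ⟨?_⟩
  have h := frobNorm_sq_pos hM
  simp only [colLaw, Measure.coe_finsetSum, Finset.sum_apply, Measure.smul_apply,
    measure_univ, smul_eq_mul, mul_one]
  rw [← ENNReal.ofReal_sum_of_nonneg (fun i _ => by positivity), ← Finset.sum_div]
  simp only [colNorm, frobNorm]
  rw [Real.sq_sqrt h.le]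
  have h2 : ∀ j, √(∑ i, ‖M i j‖ ^ 2) ^ 2 = ∑ i, ‖M i j‖ ^ 2 := fun j =>
    Real.sq_sqrt (Finset.sum_nonneg fun i _ => sq_nonneg _)
  simp only [h2]
  rw [Finset.sum_comm, div_self h.ne', ENNReal.ofReal_one]

/-- The joint law of `d₁` row indices and `d₂` column indices, all drawn independently and with
replacement according to the squared row lengths and squared column lengths of `M`. -/
noncomputable def samplingLaw {𝕜 : Type*} [RCLike 𝕜] {m n : ℕ} (M : Matrix (Fin m) (Fin n) 𝕜)
    (d₁ d₂ : ℕ) : Measure ((Fin d₁ → Fin m) × (Fin d₂ → Fin n)) :=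
  (Measure.pi fun _ => rowLaw M).prod (Measure.pi fun _ => colLaw M)

/-! ### The noise-ratio bounds -/

open Classical in
/-- `β_i ≥ 0` with `β_i² = ((1 - ‖E(i,:)‖₂/‖A(i,:)‖₂) / (1 + ‖E‖_F/‖A‖_F))²`, and `β_i = 1` when
`A(i,:) = 0`. -/
noncomputable def rowRatio {𝕜 : Type*} [RCLike 𝕜] {m n : ℕ} (A E : Matrix (Fin m) (Fin n) 𝕜)
    (i : Fin m) : ℝ :=
  if A.row i = 0 then 1
  else |(1 - rowNorm E i / rowNorm A i) / (1 + frobNorm E / frobNorm A)|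

open Classical in
/-- `α_j ≥ 0` with `α_j² = ((1 - ‖E(:,j)‖₂/‖A(:,j)‖₂) / (1 + ‖E‖_F/‖A‖_F))²`, and `α_j = 1` when
`A(:,j) = 0`. -/
noncomputable def colRatio {𝕜 : Type*} [RCLike 𝕜] {m n : ℕ} (A E : Matrix (Fin m) (Fin n) 𝕜)
    (j : Fin n) : ℝ :=
  if A.col j = 0 then 1
  else |(1 - colNorm E j / colNorm A j) / (1 + frobNorm E / frobNorm A)|

/-- `β = min_i β_i`. -/
noncomputable def minRowRatio {𝕜 : Type*} [RCLike 𝕜] {m n : ℕ}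
    (A E : Matrix (Fin m) (Fin n) 𝕜) : ℝ :=
  ⨅ i, rowRatio A E i

/-- `α = min_j α_j`. -/
noncomputable def minColRatio {𝕜 : Type*} [RCLike 𝕜] {m n : ℕ}
    (A E : Matrix (Fin m) (Fin n) 𝕜) : ℝ :=
  ⨅ j, colRatio A E j

/-! ### Exact CUR decompositions -/

/-- For row indices `I` and column indices `J` (repetitions allowed), with `C = A(:,J)`,
`U = A(I,J)` and `R = A(I,:)`: `rank U = k` and `A = C U† R`. -/
def IsExactCUR {𝕜 : Type*} [RCLike 𝕜] {m n : ℕ} {ι κ : Type*} [Fintype ι] [Fintype κ]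
    (A : Matrix (Fin m) (Fin n) 𝕜) (k : ℕ) (I : ι → Fin m) (J : κ → Fin n) : Prop :=
  (A.submatrix I J).rank = k ∧
    A = A.submatrix id J * pinv (A.submatrix I J) * A.submatrix I id

/-- The sampled index lists `I`, `J` yield an exact CUR decomposition of `A`, and so do the
corresponding index sets without repeated entries. -/
def SampleSucceeds {𝕜 : Type*} [RCLike 𝕜] {m n d₁ d₂ : ℕ} (A : Matrix (Fin m) (Fin n) 𝕜) (k : ℕ)
    (I : Fin d₁ → Fin m) (J : Fin d₂ → Fin n) : Prop :=
  IsExactCUR A k I J ∧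
    IsExactCUR A k (fun i : Finset.univ.image I => (i : Fin m))
      (fun j : Finset.univ.image J => (j : Fin n))

end CUR

/-! The decomposition is exact as soon as the sampled columns span the column space of `A` and the
sampled rows span its row space. Then `A` factors through `R` and through `C`, hence through `U`,
and `U * pinv U * U = U` gives both identities (`isExactCUR_of_span_eq`). What remains is the
probability that independent samples span.

Let `S` be the span of vectors `b j` with lower frame bound `s`. Testing the frame inequality on an
orthonormal basis of the complement in `S` of a subspace `V` shows that the vectors outside `V` have
total squared length at least `s` times the codimension of `V` (`codim_mul_le_sum_norm_sq`). If each
index is drawn with probability at least `β ^ 2 * ‖b j‖ ^ 2 / G`, where `G` is the total squared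
length, then a new sample enlarges the current span with probability at least `p = β ^ 2 * s / G`
times its codimension. So the expected codimension shrinks by the factor `exp (-p)` per draw
(`sum_prod_mul_codim_le`), and Markov's inequality bounds the failure probability by `finrank S *
exp (-(p * d))`.

For the columns of `A` the frame bound is the square of the least nonzero singular value, and the
noise ratios give the required lower bound on the probabilities
(`colRatio_mul_colNorm_mul_frobNorm_le`). Rows of `A` are handled as columns of `Aᴴ`, and
independence multiplies the two probabilities. -/

namespace CUR

open MeasureTheory Module
open scoped Matrix InnerProductSpace

/-! ### Extremal singular values -/

section SingularValues

variable {𝕜 E F : Type*} [RCLike 𝕜] [NormedAddCommGroup E] [InnerProductSpace 𝕜 E]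
  [FiniteDimensional 𝕜 E] [NormedAddCommGroup F] [InnerProductSpace 𝕜 F] [FiniteDimensional 𝕜 F]

/-- Parseval in an eigenbasis of `T* T`, whose eigenvalues are the squared singular values. Both
extremal bounds below compare this sum term by term with the expansion of `‖x‖ ^ 2`. -/
theorem norm_sq_eq_sum_sq_singularValues (T : E →ₗ[𝕜] F) (x : E) :
    ‖T x‖ ^ 2 = ∑ i : Fin (finrank 𝕜 E), T.singularValues i ^ 2 *
      ‖⟪T.isSymmetric_adjoint_comp_self.eigenvectorBasis rfl i, x⟫_𝕜‖ ^ 2 := by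
  set b := T.isSymmetric_adjoint_comp_self.eigenvectorBasis rfl with hb
  have h1 : ((‖T x‖ ^ 2 : ℝ) : 𝕜) = ⟪x, (T.adjoint ∘ₗ T) x⟫_𝕜 := by
    rw [LinearMap.comp_apply, LinearMap.adjoint_inner_right, inner_self_eq_norm_sq_to_K]
    push_cast
    rfl
  have h2 : ∀ i, ⟪b i, (T.adjoint ∘ₗ T) x⟫_𝕜 =
      ((T.singularValues i ^ 2 : ℝ) : 𝕜) * ⟪b i, x⟫_𝕜 := by
    intro i
    rw [T.sq_singularValues_fin rfl, ← b.repr_apply_apply, ← b.repr_apply_apply]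
    exact T.isSymmetric_adjoint_comp_self.eigenvectorBasis_apply_self_apply rfl x i
  rw [← b.sum_inner_mul_inner] at h1
  have h3 : ∀ i, ⟪x, b i⟫_𝕜 * ⟪b i, (T.adjoint ∘ₗ T) x⟫_𝕜 =
      ((T.singularValues i ^ 2 * ‖⟪b i, x⟫_𝕜‖ ^ 2 : ℝ) : 𝕜) := by
    intro i
    rw [h2, mul_left_comm, ← inner_conj_symm x (b i), RCLike.conj_mul]
    push_cast
    rfl
  simp only [h3] at h1
  exact_mod_cast h1

theorem norm_le_singularValues_zero_mul (T : E →ₗ[𝕜] F) (x : E) :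
    ‖T x‖ ≤ T.singularValues 0 * ‖x‖ := by
  refine le_of_sq_le_sq ?_ (mul_nonneg (T.singularValues_nonneg 0) (norm_nonneg x))
  rw [norm_sq_eq_sum_sq_singularValues, mul_pow,
    ← (T.isSymmetric_adjoint_comp_self.eigenvectorBasis rfl).sum_sq_norm_inner_right x,
    Finset.mul_sum]
  gcongr with i
  · exact T.singularValues_nonneg _
  · exact T.singularValues_antitone (Nat.zero_le _)

/-- Off its kernel, a linear map is bounded below by its least nonzero singular value. -/
theorem singularValues_mul_norm_le (T : E →ₗ[𝕜] F) {x : E} (hx : x ∈ T.kerᗮ) :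
    T.singularValues (finrank 𝕜 T.range - 1) * ‖x‖ ≤ ‖T x‖ := by
  refine le_of_sq_le_sq ?_ (norm_nonneg _)
  rw [norm_sq_eq_sum_sq_singularValues, mul_pow,
    ← (T.isSymmetric_adjoint_comp_self.eigenvectorBasis rfl).sum_sq_norm_inner_right x,
    Finset.mul_sum]
  refine Finset.sum_le_sum fun i _ => ?_
  by_cases hi : (i : ℕ) < finrank 𝕜 T.range
  · gcongr
    · exact T.singularValues_nonneg _
    · exact T.singularValues_antitone (by omega)
  -- Beyond the rank, the eigenvector lies in the kernel of `T* T`, which is that of `T`, so it is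
  -- orthogonal to `x` and both terms vanish.
  · have h0 : T.singularValues i = 0 :=
      T.singularValues_eq_zero_iff_le_finrank_range.2 (not_lt.1 hi)
    set e := T.isSymmetric_adjoint_comp_self.eigenvectorBasis rfl with he
    have hker : e i ∈ T.ker := by
      rw [← T.ker_adjoint_comp_self, LinearMap.mem_ker, he,
        T.isSymmetric_adjoint_comp_self.apply_eigenvectorBasis, ← T.sq_singularValues_fin, h0]
      simp
    rw [Submodule.inner_right_of_mem_orthogonal hker hx]
    simp

/-- The lower bound on the orthogonal complement of the kernel passes to the adjoint. -/
theorem singularValues_mul_norm_le_adjoint (T : E →ₗ[𝕜] F) {w : F} (hw : w ∈ T.range) :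
    T.singularValues (finrank 𝕜 T.range - 1) * ‖w‖ ≤ ‖T.adjoint w‖ := by
  obtain ⟨y, rfl⟩ := hw
  obtain ⟨u, hu, x, hx, rfl⟩ := T.ker.exists_add_mem_mem_orthogonal y
  rw [map_add, LinearMap.mem_ker.1 hu, zero_add]
  have h1 := singularValues_mul_norm_le T hx
  -- Cauchy–Schwarz for `⟪x, T* T x⟫`. Combined with `h1`, division by `‖T x‖` gives the claim.
  have h2 : ‖T x‖ ^ 2 ≤ ‖x‖ * ‖T.adjoint (T x)‖ := by
    rw [← inner_self_eq_norm_sq (𝕜 := 𝕜), ← LinearMap.adjoint_inner_right]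
    exact (RCLike.re_le_norm _).trans (norm_inner_le_norm _ _)
  set s := T.singularValues (finrank 𝕜 T.range - 1)
  have hs : 0 ≤ s := T.singularValues_nonneg _
  rcases (norm_nonneg (T x)).eq_or_lt with h | h
  · rw [← h]; simp
  · refine le_of_mul_le_mul_right ?_ h
    calc s * ‖T x‖ * ‖T x‖ = s * ‖T x‖ ^ 2 := by ring
      _ ≤ s * (‖x‖ * ‖T.adjoint (T x)‖) := by gcongr
      _ = s * ‖x‖ * ‖T.adjoint (T x)‖ := by ring
      _ ≤ ‖T x‖ * ‖T.adjoint (T x)‖ := by gcongr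
      _ = _ := mul_comm _ _

end SingularValues

/-! ### Random sampling of vectors until they span -/

section Sampling

open scoped Classical in
/-- If vectors `b j` form a frame with lower bound `s` for their span, then those outside a subspace
have total squared length at least `s` times its codimension. -/
theorem codim_mul_le_sum_norm_sq {𝕜 F ι : Type*} [RCLike 𝕜] [NormedAddCommGroup F]
    [InnerProductSpace 𝕜 F] [FiniteDimensional 𝕜 F] [Fintype ι] (b : ι → F) {s : ℝ}
    (hs : ∀ w ∈ Submodule.span 𝕜 (Set.range b), s * ‖w‖ ^ 2 ≤ ∑ j, ‖⟪b j, w⟫_𝕜‖ ^ 2)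
    {V : Submodule 𝕜 F} (hV : V ≤ Submodule.span 𝕜 (Set.range b)) :
    s * (finrank 𝕜 (Submodule.span 𝕜 (Set.range b)) - finrank 𝕜 V : ℝ) ≤
      ∑ j, if b j ∈ V then 0 else ‖b j‖ ^ 2 := by
  set S := Submodule.span 𝕜 (Set.range b)
  -- The dimension of `W` is the codimension of `V` in `S`. The frame inequality is summed over an
  -- orthonormal basis of `W`: vectors in `V` contribute nothing, and Bessel bounds every other
  -- contribution by `‖b j‖ ^ 2`.
  let W : Submodule 𝕜 F := Vᗮ ⊓ S
  have hdim : (finrank 𝕜 S - finrank 𝕜 V : ℝ) = finrank 𝕜 W := by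
    have := Submodule.finrank_add_inf_finrank_orthogonal hV
    rw [← this]
    push_cast
    ring
  let o := stdOrthonormalBasis 𝕜 W
  have ho : Orthonormal 𝕜 fun l => (o l : F) := o.orthonormal.comp_linearIsometry W.subtypeₗᵢ
  calc s * (finrank 𝕜 S - finrank 𝕜 V : ℝ) = ∑ l, s * ‖(o l : F)‖ ^ 2 := by
        rw [hdim]
        simp [ho.1, mul_comm]
    _ ≤ ∑ l, ∑ j, ‖⟪b j, (o l : F)⟫_𝕜‖ ^ 2 := Finset.sum_le_sum fun l _ => hs _ (o l).2.2
    _ = ∑ j, ∑ l, ‖⟪b j, (o l : F)⟫_𝕜‖ ^ 2 := Finset.sum_comm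
    _ ≤ ∑ j, if b j ∈ V then 0 else ‖b j‖ ^ 2 := by
        refine Finset.sum_le_sum fun j _ => ?_
        split_ifs with hj
        · refine le_of_eq (Finset.sum_eq_zero fun l _ => ?_)
          rw [Submodule.inner_right_of_mem_orthogonal hj (o l).2.1]
          simp
        · refine le_trans (le_of_eq ?_) (ho.sum_inner_products_le (b j) (s := Finset.univ))
          simp only [norm_inner_symm (b j)]

open scoped Classical in
/-- If each new sample leaves a subspace of the span with probability at least `p` times its
codimension, then the expected codimension decays exponentially. -/
theorem sum_prod_mul_codim_le {𝕜 F ι : Type*} [Field 𝕜] [AddCommGroup F] [Module 𝕜 F]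
    [FiniteDimensional 𝕜 F] [Fintype ι] (b : ι → F) (q : ι → ℝ) (hq : ∀ i, 0 ≤ q i)
    (hq1 : ∑ i, q i = 1) {p : ℝ}
    (hp : ∀ V ≤ Submodule.span 𝕜 (Set.range b),
      p * (finrank 𝕜 (Submodule.span 𝕜 (Set.range b)) - finrank 𝕜 V : ℝ) ≤
        ∑ i, if b i ∈ V then 0 else q i) (d : ℕ) :
    ∑ I : Fin d → ι, (∏ t, q (I t)) * (finrank 𝕜 (Submodule.span 𝕜 (Set.range b)) -
        finrank 𝕜 (Submodule.span 𝕜 (Set.range (b ∘ I))) : ℝ) ≤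
      finrank 𝕜 (Submodule.span 𝕜 (Set.range b)) * Real.exp (-(p * d)) := by
  set S := Submodule.span 𝕜 (Set.range b)
  have hle : ∀ {d : ℕ} (I : Fin d → ι), Submodule.span 𝕜 (Set.range (b ∘ I)) ≤ S := fun I =>
    Submodule.span_mono (Set.range_comp_subset_range I b)
  induction d with
  | zero => simp
  | succ d ih =>
    -- Conditionally on the first `d` draws, a new vector outside `V` lowers the codimension by at
    -- least one. This has probability at least `p` times the codimension, so the mean is multiplied
    -- by at most `1 - p ≤ exp (-p)`.
    have step : ∀ I : Fin d → ι,
        ∑ i, q i * (finrank 𝕜 S -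
          finrank 𝕜 (Submodule.span 𝕜 (Set.range (b ∘ (Fin.cons i I : Fin (d + 1) → ι)))) : ℝ) ≤
        Real.exp (-p) *
          (finrank 𝕜 S - finrank 𝕜 (Submodule.span 𝕜 (Set.range (b ∘ I))) : ℝ) := by
      intro I
      set V := Submodule.span 𝕜 (Set.range (b ∘ I)) with hVdef
      have hD : (0 : ℝ) ≤ finrank 𝕜 S - finrank 𝕜 V :=
        sub_nonneg.2 (by exact_mod_cast Submodule.finrank_mono (hle I))
      have hi : ∀ i, q i * (finrank 𝕜 S - finrank 𝕜
          (Submodule.span 𝕜 (Set.range (b ∘ (Fin.cons i I : Fin (d + 1) → ι)))) : ℝ) ≤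
          q i * (finrank 𝕜 S - finrank 𝕜 V) - if b i ∈ V then 0 else q i := by
        intro i
        have hVi : V ≤ Submodule.span 𝕜 (Set.range (b ∘ (Fin.cons i I : Fin (d + 1) → ι))) := by
          refine Submodule.span_mono ?_
          rintro _ ⟨t, rfl⟩
          exact ⟨t.succ, by simp⟩
        split_ifs with h
        · rw [sub_zero]
          gcongr
          · exact hq i
          · exact Submodule.finrank_mono hVi
        · have hlt : V < Submodule.span 𝕜 (Set.range (b ∘ (Fin.cons i I : Fin (d + 1) → ι))) := by
            refine lt_of_le_of_ne hVi fun heq => h ?_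
            rw [heq]
            exact Submodule.subset_span ⟨0, by simp⟩
          have h1 : (finrank 𝕜 V : ℝ) + 1 ≤ finrank 𝕜
              (Submodule.span 𝕜 (Set.range (b ∘ (Fin.cons i I : Fin (d + 1) → ι)))) := by
            exact_mod_cast Submodule.finrank_lt_finrank_of_lt hlt
          nlinarith [hq i]
      calc _ ≤ ∑ i, (q i * (finrank 𝕜 S - finrank 𝕜 V : ℝ) - if b i ∈ V then 0 else q i) :=
            Finset.sum_le_sum fun i _ => hi i
        _ = (finrank 𝕜 S - finrank 𝕜 V : ℝ) - ∑ i, if b i ∈ V then 0 else q i := by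
            rw [Finset.sum_sub_distrib, ← Finset.sum_mul, hq1, one_mul]
        _ ≤ (-p + 1) * (finrank 𝕜 S - finrank 𝕜 V : ℝ) := by linarith [hp V (hle I)]
        _ ≤ _ := by
            gcongr
            exact Real.add_one_le_exp _
    rw [← (Fin.consEquiv fun _ : Fin (d + 1) => ι).sum_comp, Fintype.sum_prod_type_right]
    calc _ ≤ ∑ I : Fin d → ι, (∏ t, q (I t)) * (Real.exp (-p) *
          (finrank 𝕜 S - finrank 𝕜 (Submodule.span 𝕜 (Set.range (b ∘ I))) : ℝ)) := by
          refine Finset.sum_le_sum fun I _ => ?_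
          refine le_trans (le_of_eq ?_) (mul_le_mul_of_nonneg_left (step I)
            (Finset.prod_nonneg fun t _ => hq _))
          rw [Finset.mul_sum]
          refine Finset.sum_congr rfl fun i _ => ?_
          change (∏ t, q ((Fin.cons i I : Fin (d + 1) → ι) t)) * (finrank 𝕜 S - finrank 𝕜
            (Submodule.span 𝕜 (Set.range (b ∘ (Fin.cons i I : Fin (d + 1) → ι)))) : ℝ) = _
          simp only [Fin.prod_univ_succ, Fin.cons_zero, Fin.cons_succ]
          ring
      _ = Real.exp (-p) * ∑ I : Fin d → ι, (∏ t, q (I t)) *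
          (finrank 𝕜 S - finrank 𝕜 (Submodule.span 𝕜 (Set.range (b ∘ I))) : ℝ) := by
          rw [Finset.mul_sum]
          exact Finset.sum_congr rfl fun I _ => by ring
      _ ≤ Real.exp (-p) * (finrank 𝕜 S * Real.exp (-(p * d))) := by gcongr
      _ = _ := by
          rw [mul_left_comm, ← Real.exp_add]
          congr 2
          push_cast
          ring

open scoped Classical in
/-- The probability that independent samples fail to span decays exponentially. -/
theorem pi_real_span_ne_le {𝕜 F ι : Type*} [Field 𝕜] [AddCommGroup F] [Module 𝕜 F]
    [FiniteDimensional 𝕜 F] [Fintype ι] [MeasurableSpace ι] [MeasurableSingletonClass ι]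
    (b : ι → F) (μ : Measure ι) [IsProbabilityMeasure μ] {p : ℝ}
    (hp : ∀ V ≤ Submodule.span 𝕜 (Set.range b),
      p * (finrank 𝕜 (Submodule.span 𝕜 (Set.range b)) - finrank 𝕜 V : ℝ) ≤
        ∑ i, if b i ∈ V then 0 else μ.real {i}) (d : ℕ) :
    (Measure.pi fun _ : Fin d => μ).real
        {I | Submodule.span 𝕜 (Set.range (b ∘ I)) ≠ Submodule.span 𝕜 (Set.range b)} ≤
      finrank 𝕜 (Submodule.span 𝕜 (Set.range b)) * Real.exp (-(p * d)) := by
  -- Markov's inequality: the codimension is a natural number, hence at least one whenever the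
  -- sample fails to span.
  refine le_trans ?_ (sum_prod_mul_codim_le b (fun i => μ.real {i}) (fun i => measureReal_nonneg)
    (by simp) hp d)
  set B := {I : Fin d → ι | Submodule.span 𝕜 (Set.range (b ∘ I)) ≠ Submodule.span 𝕜 (Set.range b)}
  have hB : (Measure.pi fun _ : Fin d => μ).real B =
      ∑ I ∈ B.toFinset, ∏ t, μ.real {I t} := by
    rw [← congrArg (Measure.pi fun _ : Fin d => μ).real (Set.coe_toFinset B),
      ← sum_measureReal_singleton]
    simp [measureReal_def, Measure.pi_singleton, ENNReal.toReal_prod]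
  have hle : ∀ I : Fin d → ι,
      Submodule.span 𝕜 (Set.range (b ∘ I)) ≤ Submodule.span 𝕜 (Set.range b) := fun I =>
    Submodule.span_mono (Set.range_comp_subset_range I b)
  rw [hB]
  refine (Finset.sum_le_sum fun I hI => ?_).trans
    (Finset.sum_le_univ_sum_of_nonneg (s := B.toFinset) fun I => ?_)
  · have hlt := Submodule.finrank_lt_finrank_of_lt (lt_of_le_of_ne (hle I) (by simpa [B] using hI))
    refine le_mul_of_one_le_right (Finset.prod_nonneg fun t _ => measureReal_nonneg) ?_
    rw [le_sub_iff_add_le, add_comm]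
    exact_mod_cast hlt
  · refine mul_nonneg (Finset.prod_nonneg fun t _ => measureReal_nonneg) (sub_nonneg.2 ?_)
    exact_mod_cast Submodule.finrank_mono (hle I)

end Sampling

/-! ### Sampling a frame with probabilities bounded below by squared lengths -/

section Frame

variable {𝕜 F ι : Type*} [RCLike 𝕜] [NormedAddCommGroup F] [InnerProductSpace 𝕜 F]
  [FiniteDimensional 𝕜 F] [Fintype ι]

/-- The dimension of the span is controlled by the frame bound and the total squared length. -/
theorem finrank_span_mul_le_sum_norm_sq (b : ι → F) {s : ℝ}
    (hs : ∀ w ∈ Submodule.span 𝕜 (Set.range b), s * ‖w‖ ^ 2 ≤ ∑ j, ‖⟪b j, w⟫_𝕜‖ ^ 2) :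
    s * finrank 𝕜 (Submodule.span 𝕜 (Set.range b)) ≤ ∑ j, ‖b j‖ ^ 2 := by
  classical
  have h := codim_mul_le_sum_norm_sq b hs bot_le
  rw [finrank_bot, Nat.cast_zero, sub_zero] at h
  refine h.trans (Finset.sum_le_sum fun j _ => ?_)
  split_ifs
  · positivity
  · rfl

variable [MeasurableSpace ι] [MeasurableSingletonClass ι]

/-- Failure probability for sampling a frame with probabilities at least `β²` times the squared
lengths. -/
theorem pi_real_span_ne_le_of_frame (b : ι → F) {s : ℝ}
    (hs : ∀ w ∈ Submodule.span 𝕜 (Set.range b), s * ‖w‖ ^ 2 ≤ ∑ j, ‖⟪b j, w⟫_𝕜‖ ^ 2)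
    (μ : Measure ι) [IsProbabilityMeasure μ] {G β : ℝ} (hG : 0 < G)
    (hμ : ∀ j, β ^ 2 * ‖b j‖ ^ 2 ≤ G * μ.real {j}) (d : ℕ) :
    (Measure.pi fun _ : Fin d => μ).real
        {I | Submodule.span 𝕜 (Set.range (b ∘ I)) ≠ Submodule.span 𝕜 (Set.range b)} ≤
      finrank 𝕜 (Submodule.span 𝕜 (Set.range b)) * Real.exp (-(β ^ 2 * s / G * d)) := by
  classical
  refine pi_real_span_ne_le b μ (fun V hV => ?_) d
  have h := codim_mul_le_sum_norm_sq b hs hV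
  rw [div_mul_eq_mul_div, div_le_iff₀ hG, Finset.sum_mul, mul_assoc]
  refine (mul_le_mul_of_nonneg_left h (sq_nonneg β)).trans ?_
  rw [Finset.mul_sum]
  refine Finset.sum_le_sum fun j _ => ?_
  by_cases hj : b j ∈ V
  · simp [hj]
  · simpa [hj, mul_comm (μ.real {j})] using hμ j

/-- The success probability of sampling a frame, in terms of the number of samples. -/
theorem le_pi_real_span_eq_of_frame (b : ι → F) {s : ℝ}
    (hs : ∀ w ∈ Submodule.span 𝕜 (Set.range b), s * ‖w‖ ^ 2 ≤ ∑ j, ‖⟪b j, w⟫_𝕜‖ ^ 2)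
    (μ : Measure ι) [IsProbabilityMeasure μ] {β r δ ε : ℝ}
    (hb : 0 < ∑ j, ‖b j‖ ^ 2)
    (hμ : ∀ j, β ^ 2 * ‖b j‖ ^ 2 ≤ (∑ j, ‖b j‖ ^ 2) * μ.real {j})
    (hδ : 0 < δ) (hε : 0 < ε) (hε1 : ε ≤ 1) (hr : 0 < r)
    (hεs : ε ^ 2 * (∑ j, ‖b j‖ ^ 2) ≤ s * r) {d : ℕ}
    (hd : 2 * (r / (ε ^ 4 * δ) * Real.log (r / (ε ^ 4 * δ))) ≤ d) :
    max 0 (1 - 2 * Real.exp (-(1 / 8 * β ^ 2 / δ))) ≤ (Measure.pi fun _ : Fin d => μ).real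
        {I | Submodule.span 𝕜 (Set.range (b ∘ I)) = Submodule.span 𝕜 (Set.range b)} := by
  classical
  have hfail := pi_real_span_ne_le_of_frame b hs μ hb hμ d
  have hks := finrank_span_mul_le_sum_norm_sq b hs
  set G := ∑ j, ‖b j‖ ^ 2
  set k := finrank 𝕜 (Submodule.span 𝕜 (Set.range b)) with hk
  refine max_le measureReal_nonneg ?_
  set x := β ^ 2 / δ with hx
  rw [mul_div_assoc]
  have hx0 : 0 ≤ x := by positivity
  -- For `x ≤ 4` the claimed bound is nonpositive, since `exp (-x / 8) ≥ 1 - x / 8 ≥ 1 / 2`; this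
  -- range fixes the constant `1 / 8`.
  by_cases hxs : x ≤ 4
  · refine le_trans ?_ measureReal_nonneg
    have h1 := Real.add_one_le_exp (-(1 / 8 * x))
    linarith
  push Not at hxs
  -- Sum `hμ` over all indices; the probabilities add up to one.
  have hβ1 : β ^ 2 ≤ 1 := by
    have h1 : β ^ 2 * G ≤ G * 1 := by
      have h2 : ∑ j, μ.real {j} = 1 := by simp
      rw [← h2, Finset.mul_sum, Finset.mul_sum]
      exact Finset.sum_le_sum fun j _ => hμ j
    nlinarith
  have hspos : 0 < s := by
    have : 0 < s * r := lt_of_lt_of_le (by positivity) hεs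
    exact pos_of_mul_pos_left this hr.le
  have hk1 : (1 : ℝ) ≤ k := by
    have : 0 < k := by
      rw [hk, finrank_pos_iff, Submodule.nontrivial_iff_ne_bot]
      intro hbot
      rw [Submodule.span_eq_bot] at hbot
      refine hb.ne' (Finset.sum_eq_zero fun j _ => ?_)
      simp [hbot (b j) ⟨j, rfl⟩]
    exact_mod_cast this
  have hkε : k * ε ^ 2 ≤ r := by
    refine le_of_mul_le_mul_left ?_ hspos
    calc s * (k * ε ^ 2) = ε ^ 2 * (s * k) := by ring
      _ ≤ ε ^ 2 * G := by gcongr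
      _ ≤ s * r := hεs
  set y := r / (ε ^ 4 * δ) with hy
  have hδ4 : 4 * δ ≤ 1 := by
    rw [hx, lt_div_iff₀ hδ] at hxs
    linarith
  have hε2 : ε ^ 2 ≤ 1 := pow_le_one₀ hε.le hε1
  -- The factor 4 comes from `4 * δ ≤ 1`, that is, from `x > 4` and `β ^ 2 ≤ 1`. It ensures `y ≥ 4 >
  -- e`, hence `L ≥ 1`, while `k ≤ y = exp L` lets the dimension be absorbed in the exponential.
  have hky : 4 * (k : ℝ) ≤ y := by
    rw [hy, le_div_iff₀ (by positivity)]
    calc 4 * (k : ℝ) * (ε ^ 4 * δ) = (k * ε ^ 2) * ε ^ 2 * (4 * δ) := by ring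
      _ ≤ r * 1 * 1 := by gcongr
      _ = r := by ring
  have hypos : 0 < y := by linarith
  set L := Real.log y with hL
  have hL1 : 1 ≤ L := by
    rw [hL, Real.le_log_iff_exp_le hypos]
    linarith [Real.exp_one_lt_d9]
  have hkL : (k : ℝ) ≤ Real.exp L := by
    rw [hL, Real.exp_log hypos]
    linarith
  -- The decay rate is at least `β ^ 2 * (ε ^ 2 / r)`, whose product with `y` is `x / ε ^ 2 ≥ x`;
  -- the number of draws is at least `2 * y * L`.
  have hpd : 2 * x * L ≤ β ^ 2 * s / G * d := by
    have h1 : ε ^ 2 / r ≤ s / G := by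
      rw [div_le_div_iff₀ hr hb]
      exact hεs
    have h2 : x ≤ β ^ 2 * (ε ^ 2 / r) * y := by
      have h3 : β ^ 2 * (ε ^ 2 / r) * y = x / ε ^ 2 := by
        rw [hy, hx]
        field_simp
      rw [h3, le_div_iff₀ (by positivity)]
      exact mul_le_of_le_one_right hx0 hε2
    calc 2 * x * L ≤ 2 * (β ^ 2 * (ε ^ 2 / r) * y) * L := by gcongr
      _ = β ^ 2 * (ε ^ 2 / r) * (2 * (y * L)) := by ring
      _ ≤ β ^ 2 * (s / G) * d := by gcongr
      _ = _ := by ring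
  have hfail' : (Measure.pi fun _ : Fin d => μ).real
      {I | Submodule.span 𝕜 (Set.range (b ∘ I)) ≠ Submodule.span 𝕜 (Set.range b)} ≤
      2 * Real.exp (-(1 / 8 * x)) := by
    calc _ ≤ k * Real.exp (-(β ^ 2 * s / G * d)) := hfail
      _ ≤ Real.exp L * Real.exp (-(2 * x * L)) := by gcongr
      _ = Real.exp (L - 2 * x * L) := by rw [← Real.exp_add]; ring_nf
      -- As `L ≥ 1` and `x > 4`, `L * (1 - 2 * x) ≤ 1 - 2 * x ≤ -x / 8`.
      _ ≤ Real.exp (-(1 / 8 * x)) := Real.exp_le_exp.2 (by nlinarith)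
      _ ≤ _ := by linarith [Real.exp_pos (-(1 / 8 * x))]
  have hcompl := probReal_compl_eq_one_sub (μ := Measure.pi fun _ : Fin d => μ)
    (s := {I | Submodule.span 𝕜 (Set.range (b ∘ I)) ≠ Submodule.span 𝕜 (Set.range b)})
    (Set.toFinite _).measurableSet
  have hset : {I : Fin d → ι | Submodule.span 𝕜 (Set.range (b ∘ I)) ≠
      Submodule.span 𝕜 (Set.range b)}ᶜ =
      {I | Submodule.span 𝕜 (Set.range (b ∘ I)) = Submodule.span 𝕜 (Set.range b)} := by
    ext I
    simp
  rw [hset] at hcompl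
  linarith

end Frame

/-! ### Columns of a matrix and their sampling law -/

variable {𝕜 : Type*} [RCLike 𝕜] {m n : ℕ}

/-- The column `A(:,j)` as a vector in Euclidean space. -/
noncomputable def colVec (A : Matrix (Fin m) (Fin n) 𝕜) (j : Fin n) :
    EuclideanSpace 𝕜 (Fin m) :=
  WithLp.toLp 2 (A.col j)

theorem norm_colVec (A : Matrix (Fin m) (Fin n) 𝕜) (j : Fin n) : ‖colVec A j‖ = colNorm A j :=
  EuclideanSpace.norm_eq _

theorem colVec_add (A E : Matrix (Fin m) (Fin n) 𝕜) (j : Fin n) :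
    colVec (A + E) j = colVec A j + colVec E j := rfl

theorem frobNorm_eq_norm (A : Matrix (Fin m) (Fin n) 𝕜) :
    frobNorm A = ‖(WithLp.toLp 2 fun p : Fin m × Fin n => A p.1 p.2 :
      EuclideanSpace 𝕜 (Fin m × Fin n))‖ := by
  rw [EuclideanSpace.norm_eq, frobNorm, Fintype.sum_prod_type]

theorem frobNorm_add_le (A E : Matrix (Fin m) (Fin n) 𝕜) :
    frobNorm (A + E) ≤ frobNorm A + frobNorm E := by
  simp only [frobNorm_eq_norm]
  exact norm_add_le (WithLp.toLp 2 fun p : Fin m × Fin n => A p.1 p.2 :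
      EuclideanSpace 𝕜 (Fin m × Fin n)) (WithLp.toLp 2 fun p : Fin m × Fin n => E p.1 p.2)

theorem frobNorm_pos {A : Matrix (Fin m) (Fin n) 𝕜} (hA : A ≠ 0) : 0 < frobNorm A :=
  Real.sqrt_pos.2 (frobNorm_sq_pos hA)

theorem sum_norm_colVec_sq (A : Matrix (Fin m) (Fin n) 𝕜) :
    ∑ j, ‖colVec A j‖ ^ 2 = frobNorm A ^ 2 := by
  rw [frobNorm, Real.sq_sqrt (by positivity), Finset.sum_comm]
  refine Finset.sum_congr rfl fun j _ => ?_
  rw [norm_colVec, colNorm, Real.sq_sqrt (by positivity)]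

theorem toEuclideanLin_single (A : Matrix (Fin m) (Fin n) 𝕜) (j : Fin n) :
    Matrix.toEuclideanLin A (EuclideanSpace.single j 1) = colVec A j := by
  ext i
  simp [colVec, Matrix.toLpLin_apply]

theorem span_range_colVec (A : Matrix (Fin m) (Fin n) 𝕜) :
    Submodule.span 𝕜 (Set.range (colVec A)) = (Matrix.toEuclideanLin A).range := by
  rw [LinearMap.range_eq_map, ← (EuclideanSpace.basisFun (Fin n) 𝕜).toBasis.span_eq,
    Submodule.map_span, ← Set.range_comp]
  congr 2
  ext1 j
  simp [toEuclideanLin_single]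

theorem finrank_range_toEuclideanLin (A : Matrix (Fin m) (Fin n) 𝕜) :
    finrank 𝕜 (Matrix.toEuclideanLin A).range = A.rank := by
  rw [Matrix.toEuclideanLin, Matrix.toLpLin_eq_toLin, ← Matrix.rank_eq_finrank_range_toLin]

theorem sum_norm_inner_colVec_sq (A : Matrix (Fin m) (Fin n) 𝕜) (w : EuclideanSpace 𝕜 (Fin m)) :
    ∑ j, ‖⟪colVec A j, w⟫_𝕜‖ ^ 2 = ‖(Matrix.toEuclideanLin A).adjoint w‖ ^ 2 := by
  rw [EuclideanSpace.norm_sq_eq]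
  refine Finset.sum_congr rfl fun j _ => ?_
  rw [← toEuclideanLin_single, ← LinearMap.adjoint_inner_right,
    EuclideanSpace.inner_single_left]
  simp

/-- The reverse triangle inequality bounds the perturbed column from below, and the triangle
inequality bounds the perturbed Frobenius norm from above. Squared, this compares the perturbed
sampling probability with the exact one. A zero column makes the left side vanish, so the default
ratio 1 is harmless. -/
theorem colRatio_mul_colNorm_mul_frobNorm_le (A E : Matrix (Fin m) (Fin n) 𝕜) (hA : A ≠ 0) (j : Fin n) :
    colRatio A E j * colNorm A j * frobNorm (A + E) ≤ frobNorm A * colNorm (A + E) j := by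
  unfold colRatio
  split_ifs with h
  · have h0 : colNorm A j = 0 := by
      rw [← norm_colVec, colVec, h]
      simp
    rw [h0, mul_zero, zero_mul]
    exact mul_nonneg (Real.sqrt_nonneg _) (Real.sqrt_nonneg _)
  · have ha : 0 < colNorm A j := by
      rw [← norm_colVec, norm_pos_iff]
      exact fun h0 => h (congrArg WithLp.ofLp h0)
    have hf := frobNorm_pos hA
    have hg : 0 ≤ frobNorm E := Real.sqrt_nonneg _
    have h1 : |colNorm A j - colNorm E j| ≤ colNorm (A + E) j := by
      simp only [← norm_colVec, colVec_add]
      have := abs_norm_sub_norm_le (colVec A j) (-colVec E j)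
      rwa [norm_neg, sub_neg_eq_add] at this
    have h2 : |(1 - colNorm E j / colNorm A j) / (1 + frobNorm E / frobNorm A)| * colNorm A j =
        |colNorm A j - colNorm E j| * frobNorm A / (frobNorm A + frobNorm E) := by
      have h3 : (1 - colNorm E j / colNorm A j) / (1 + frobNorm E / frobNorm A) =
          (colNorm A j - colNorm E j) * (frobNorm A / (colNorm A j * (frobNorm A + frobNorm E))) := by
        have : frobNorm A + frobNorm E ≠ 0 := by positivity
        field_simp
      rw [h3, abs_mul, abs_of_pos (a := frobNorm A / _) (by positivity)]
      field_simp
    rw [h2, div_mul_eq_mul_div, div_le_iff₀ (by positivity)]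
    calc |colNorm A j - colNorm E j| * frobNorm A * frobNorm (A + E) ≤
        colNorm (A + E) j * frobNorm A * (frobNorm A + frobNorm E) := by
          gcongr
          · exact Real.sqrt_nonneg _
          · exact mul_nonneg (Real.sqrt_nonneg _) hf.le
          · exact frobNorm_add_le A E
      _ = _ := by ring

theorem colLaw_real_singleton (M : Matrix (Fin m) (Fin n) 𝕜) (j : Fin n) :
    (colLaw M).real {j} = colNorm M j ^ 2 / frobNorm M ^ 2 := by
  have h : colLaw M {j} = ENNReal.ofReal (colNorm M j ^ 2 / frobNorm M ^ 2) := by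
    simp only [colLaw, Measure.coe_finsetSum, Finset.sum_apply, Measure.smul_apply, smul_eq_mul]
    rw [Finset.sum_eq_single j]
    · simp
    · intro b _ hb
      simp [hb]
    · simp
  rw [measureReal_def, h, ENNReal.toReal_ofReal (by positivity)]

theorem minColRatio_le (A E : Matrix (Fin m) (Fin n) 𝕜) (j : Fin n) :
    minColRatio A E ≤ colRatio A E j :=
  ciInf_le (Set.finite_range _).bddBelow j

theorem minColRatio_nonneg (A E : Matrix (Fin m) (Fin n) 𝕜) : 0 ≤ minColRatio A E := by
  refine Real.iInf_nonneg fun j => ?_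
  unfold colRatio
  split_ifs <;> positivity

theorem add_ne_zero_of_col {A E : Matrix (Fin m) (Fin n) 𝕜} (hA : A ≠ 0)
    (h : ∀ j, (A + E).col j = 0 → A.col j = 0) : A + E ≠ 0 := by
  intro h0
  refine hA (Matrix.ext fun i j => congrFun (h j ?_) i)
  rw [h0]
  rfl

/-! ### Conjugate transposes exchange rows and columns -/

theorem colNorm_conjTranspose (A : Matrix (Fin m) (Fin n) 𝕜) : colNorm Aᴴ = rowNorm A := by
  ext i
  simp [colNorm, rowNorm]

theorem frobNorm_conjTranspose (A : Matrix (Fin m) (Fin n) 𝕜) : frobNorm Aᴴ = frobNorm A := by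
  simp only [frobNorm, Matrix.conjTranspose_apply, norm_star]
  rw [Finset.sum_comm]

theorem colLaw_conjTranspose (A : Matrix (Fin m) (Fin n) 𝕜) : colLaw Aᴴ = rowLaw A := by
  simp only [colLaw, rowLaw, colNorm_conjTranspose, frobNorm_conjTranspose]

theorem col_conjTranspose_eq_zero (A : Matrix (Fin m) (Fin n) 𝕜) (i : Fin m) :
    Aᴴ.col i = 0 ↔ A.row i = 0 := by
  simp [funext_iff]

theorem minColRatio_conjTranspose (A E : Matrix (Fin m) (Fin n) 𝕜) :
    minColRatio Aᴴ Eᴴ = minRowRatio A E := by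
  simp only [minColRatio, minRowRatio, colRatio, rowRatio, colNorm_conjTranspose,
    frobNorm_conjTranspose, col_conjTranspose_eq_zero]

/-! ### Exactness from spanning rows and columns -/

theorem exists_eq_submatrix_mul {κ : Type*} [Fintype κ] {A : Matrix (Fin m) (Fin n) 𝕜}
    {J : κ → Fin n}
    (hJ : Submodule.span 𝕜 (Set.range (colVec A ∘ J)) = Submodule.span 𝕜 (Set.range (colVec A))) :
    ∃ Y : Matrix κ (Fin n) 𝕜, A = A.submatrix id J * Y := by
  have h : ∀ j, ∃ c : κ → 𝕜, ∑ l, c l • colVec A (J l) = colVec A j := fun j => by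
    refine (Submodule.mem_span_range_iff_exists_fun 𝕜 (v := colVec A ∘ J)).1 ?_
    rw [hJ]
    exact Submodule.subset_span ⟨j, rfl⟩
  choose c hc using h
  refine ⟨Matrix.of fun l j => c j l, Matrix.ext fun i j => ?_⟩
  have := congrArg (fun v : EuclideanSpace 𝕜 (Fin m) => v i) (hc j)
  simp only [colVec, WithLp.ofLp_sum, WithLp.ofLp_smul, Finset.sum_apply, Pi.smul_apply,
    Matrix.col_apply, smul_eq_mul] at this
  rw [← this, Matrix.mul_apply]
  simp [mul_comm]

/-- Spanning gives `A = C Y` and `A = Zᴴ R`. Restricting to the sampled columns and rows gives `C =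
Zᴴ U` and `R = U Y`, so `A = Zᴴ U Y`. This forces the rank of `U`, and only the first Penrose
equation is needed for the decomposition. -/
theorem isExactCUR_of_span_eq {ι κ : Type*} [Fintype ι] [Fintype κ]
    {A : Matrix (Fin m) (Fin n) 𝕜} {I : ι → Fin m} {J : κ → Fin n}
    (hI : Submodule.span 𝕜 (Set.range (colVec Aᴴ ∘ I)) = Submodule.span 𝕜 (Set.range (colVec Aᴴ)))
    (hJ : Submodule.span 𝕜 (Set.range (colVec A ∘ J)) = Submodule.span 𝕜 (Set.range (colVec A))) :
    IsExactCUR A A.rank I J := by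
  obtain ⟨Y, hY⟩ := exists_eq_submatrix_mul hJ
  obtain ⟨Z, hZ⟩ := exists_eq_submatrix_mul hI
  have hX : A = Zᴴ * A.submatrix I id := by
    have := congrArg Matrix.conjTranspose hZ
    rwa [Matrix.conjTranspose_conjTranspose, Matrix.conjTranspose_mul,
      Matrix.conjTranspose_submatrix, Matrix.conjTranspose_conjTranspose] at this
  set U := A.submatrix I J with hU
  have hC : A.submatrix id J = Zᴴ * U := by
    conv_lhs => rw [hX]
    rfl
  have hR : A.submatrix I id = U * Y := by
    conv_lhs => rw [hY]
    rfl
  have hA : A = Zᴴ * U * Y := by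
    rw [← hC]
    exact hY
  refine ⟨le_antisymm (Matrix.rank_submatrix_le A I J) ?_, ?_⟩
  · conv_lhs => rw [hA]
    exact (Matrix.rank_mul_le_left _ _).trans (Matrix.rank_mul_le_right _ _)
  · calc A = Zᴴ * U * Y := hA
      _ = Zᴴ * (U * pinv U * U) * Y := by rw [(isMoorePenrose_pinv U).mul_mul_self]
      _ = _ := by
        rw [← hU, hC, hR]
        simp only [Matrix.mul_assoc]

/-- A span depends only on the set of sampled indices, so discarding repetitions preserves both
spanning conditions. -/
theorem sampleSucceeds_of_span_eq {d₁ d₂ : ℕ} {A : Matrix (Fin m) (Fin n) 𝕜} {I : Fin d₁ → Fin m}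
    {J : Fin d₂ → Fin n}
    (hI : Submodule.span 𝕜 (Set.range (colVec Aᴴ ∘ I)) = Submodule.span 𝕜 (Set.range (colVec Aᴴ)))
    (hJ : Submodule.span 𝕜 (Set.range (colVec A ∘ J)) = Submodule.span 𝕜 (Set.range (colVec A))) :
    SampleSucceeds A A.rank I J := by
  refine ⟨isExactCUR_of_span_eq hI hJ, isExactCUR_of_span_eq ?_ ?_⟩
  · rw [← hI]
    simp [Set.range]
  · rw [← hJ]
    simp [Set.range]

/-! ### Sampling columns of a perturbed matrix -/

/-- Sampling columns of `A` by the squared column lengths of `A + E`. -/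
theorem le_pi_colLaw_real_span_eq {A E : Matrix (Fin m) (Fin n) 𝕜} (hA : A ≠ 0)
    (hcol : ∀ j, (A + E).col j = 0 → A.col j = 0) {s r δ ε : ℝ}
    (hs : ∀ w ∈ (Matrix.toEuclideanLin A).range,
      s * ‖w‖ ≤ ‖(Matrix.toEuclideanLin A).adjoint w‖) (hs0 : 0 ≤ s)
    (hδ : 0 < δ) (hε : 0 < ε) (hε1 : ε ≤ 1) (hr : 0 < r)
    (hεs : ε ^ 2 * frobNorm A ^ 2 ≤ s ^ 2 * r) {d : ℕ}
    (hd : 2 * (r / (ε ^ 4 * δ) * Real.log (r / (ε ^ 4 * δ))) ≤ d) :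
    max 0 (1 - 2 * Real.exp (-(1 / 8 * minColRatio A E ^ 2 / δ))) ≤
      (Measure.pi fun _ : Fin d => colLaw (A + E)).real
        {J | Submodule.span 𝕜 (Set.range (colVec A ∘ J)) =
          Submodule.span 𝕜 (Set.range (colVec A))} := by
  have hM := add_ne_zero_of_col hA hcol
  have := isProbabilityMeasure_colLaw hM
  -- The frame sum of the columns at `w` is `‖A* w‖ ^ 2`, so the frame bound is the square of the
  -- lower bound for the adjoint.
  refine le_pi_real_span_eq_of_frame (colVec A) (s := s ^ 2) (fun w hw => ?_) (colLaw (A + E))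
    ?_ (fun j => ?_) hδ hε hε1 hr ?_ hd
  · rw [sum_norm_inner_colVec_sq, ← mul_pow]
    rw [span_range_colVec] at hw
    gcongr
    exact hs w hw
  · rw [sum_norm_colVec_sq]
    have := frobNorm_pos hA
    positivity
  · rw [sum_norm_colVec_sq, colLaw_real_singleton, norm_colVec, ← mul_div_assoc, ← mul_pow,
      ← mul_pow, le_div_iff₀ (pow_pos (frobNorm_pos hM) 2), ← mul_pow]
    have h0 : 0 ≤ colNorm A j := Real.sqrt_nonneg _
    have h1 : 0 ≤ frobNorm (A + E) := Real.sqrt_nonneg _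
    have h2 := minColRatio_nonneg A E
    refine pow_le_pow_left₀ (by positivity)
      (le_trans ?_ (colRatio_mul_colNorm_mul_frobNorm_le A E hA j)) 2
    gcongr
    exact minColRatio_le A E j
  · rw [sum_norm_colVec_sq]
    exact hεs

/-! ### Singular values of `A` and the accuracy condition -/

theorem singularValues_mul_norm_le_of_mem_range_conjTranspose (A : Matrix (Fin m) (Fin n) 𝕜)
    {x : EuclideanSpace 𝕜 (Fin n)} (hx : x ∈ (Matrix.toEuclideanLin Aᴴ).range) :
    (Matrix.toEuclideanLin A).singularValues (A.rank - 1) * ‖x‖ ≤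
      ‖(Matrix.toEuclideanLin Aᴴ).adjoint x‖ := by
  rw [Matrix.toEuclideanLin_conjTranspose_eq_adjoint] at hx ⊢
  rw [LinearMap.adjoint_adjoint, ← finrank_range_toEuclideanLin]
  refine singularValues_mul_norm_le _ ?_
  rw [Submodule.mem_orthogonal]
  rintro u hu
  obtain ⟨y, rfl⟩ := hx
  rw [LinearMap.adjoint_inner_right, LinearMap.mem_ker.1 hu, inner_zero_left]

theorem specNorm_le_singularValues_zero (A : Matrix (Fin m) (Fin n) 𝕜) :
    specNorm A ≤ (Matrix.toEuclideanLin A).singularValues 0 :=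
  ContinuousLinearMap.opNorm_le_bound _ (LinearMap.singularValues_nonneg _ _) fun x =>
    norm_le_singularValues_zero_mul (Matrix.toEuclideanLin A) x

theorem specNorm_pos {A : Matrix (Fin m) (Fin n) 𝕜} (hA : A ≠ 0) : 0 < specNorm A := by
  rw [specNorm, norm_pos_iff]
  simpa using hA

theorem stableRank_pos {A : Matrix (Fin m) (Fin n) 𝕜} (hA : A ≠ 0) : 0 < stableRank A :=
  div_pos (pow_pos (frobNorm_pos hA) 2) (pow_pos (specNorm_pos hA) 2)

/-- An accuracy below the inverse condition number is at most `1`. -/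
theorem le_one_of_lt_inv_condNumber {A : Matrix (Fin m) (Fin n) 𝕜} {ε : ℝ}
    (h : ε < (condNumber A)⁻¹) : ε ≤ 1 := by
  rw [condNumber, inv_div] at h
  exact h.le.trans (div_le_one_of_le₀ (LinearMap.singularValues_antitone _ (Nat.zero_le _))
    (LinearMap.singularValues_nonneg _ _))

/-- Since `ε < σ_min / σ_max` and the spectral norm is at most `σ_max`, one has `ε * ‖A‖₂ ≤ σ_min`.
Squaring and multiplying by the stable rank turns the condition-number hypothesis into the accuracy
condition of the sampling bound. -/
theorem sq_mul_frobNorm_sq_le {A : Matrix (Fin m) (Fin n) 𝕜} (hA : A ≠ 0) {ε : ℝ} (hε : 0 < ε)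
    (h : ε < (condNumber A)⁻¹) :
    ε ^ 2 * frobNorm A ^ 2 ≤
      (Matrix.toEuclideanLin A).singularValues (A.rank - 1) ^ 2 * stableRank A := by
  have hspec := specNorm_pos hA
  have h0 := specNorm_le_singularValues_zero A
  rw [condNumber, inv_div, lt_div_iff₀ (hspec.trans_le h0)] at h
  rw [stableRank, ← mul_div_assoc, le_div_iff₀ (by positivity)]
  have h1 : ε * specNorm A ≤ (Matrix.toEuclideanLin A).singularValues (A.rank - 1) :=
    (mul_le_mul_of_nonneg_left h0 hε.le).trans h.le
  calc ε ^ 2 * frobNorm A ^ 2 * specNorm A ^ 2 = (ε * specNorm A) ^ 2 * frobNorm A ^ 2 := by ring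
    _ ≤ _ := by gcongr

end CUR

theorem mainTheorem5 :
    ∃ C c : ℝ, 0 < C ∧ 0 < c ∧
      ∀ (𝕜 : Type*) [RCLike 𝕜] (m n k d₁ d₂ : ℕ) (A E : Matrix (Fin m) (Fin n) 𝕜)
        (r α β γ δ ε : ℝ),
        A ≠ 0 → A.rank = k → r = CUR.stableRank A →
        (∀ i, (A + E).row i = 0 → A.row i = 0) →
        (∀ j, (A + E).col j = 0 → A.col j = 0) →
        α = CUR.minColRatio A E → β = CUR.minRowRatio A E → γ = min α β →
        0 < δ → δ < 1 →
        0 < ε → ε < min (CUR.condNumber A)⁻¹ (δ ^ (-(1 / 4) : ℝ) * √(2 * γ)) →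
        C * (r / (ε ^ 4 * δ) * Real.log (r / (ε ^ 4 * δ))) ≤ d₁ →
        C * (r / (ε ^ 4 * δ) * Real.log (r / (ε ^ 4 * δ))) ≤ d₂ →
        max 0 (1 - 2 * Real.exp (-(c * α ^ 2 / δ))) * max 0 (1 - 2 * Real.exp (-(c * β ^ 2 / δ))) ≤
          (CUR.samplingLaw (A + E) d₁ d₂).real {ω | CUR.SampleSucceeds A k ω.1 ω.2} := by
  refine ⟨2, 1 / 8, by norm_num, by norm_num, ?_⟩
  intro 𝕜 _ m n k d₁ d₂ A E r α β γ δ ε hA hk hr hrow hcol hα hβ _ hδ _ hε hεlt hd₁ hd₂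
  subst hk hα hβ hr
  have hεκ := hεlt.trans_le (min_le_left _ _)
  have hAH : A.conjTranspose ≠ 0 := fun h => hA (by simpa using h)
  have hM := CUR.add_ne_zero_of_col hA hcol
  have := CUR.isProbabilityMeasure_rowLaw hM
  have := CUR.isProbabilityMeasure_colLaw hM
  have hJ := CUR.le_pi_colLaw_real_span_eq hA hcol
    (fun w hw => by
      have := CUR.singularValues_mul_norm_le_adjoint (Matrix.toEuclideanLin A) hw
      rwa [CUR.finrank_range_toEuclideanLin] at this)
    (LinearMap.singularValues_nonneg _ _) hδ hε (CUR.le_one_of_lt_inv_condNumber hεκ)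
    (CUR.stableRank_pos hA) (CUR.sq_mul_frobNorm_sq_le hA hε hεκ) hd₂
  -- The range of `Aᴴ` is orthogonal to the kernel of `A`, so the same `σ_min` serves as lower bound
  -- for the rows.
  have hI := CUR.le_pi_colLaw_real_span_eq (A := A.conjTranspose) (E := E.conjTranspose) hAH
    (fun i hi => by
      rw [← Matrix.conjTranspose_add, CUR.col_conjTranspose_eq_zero] at hi
      exact (CUR.col_conjTranspose_eq_zero A i).2 (hrow i hi))
    (fun w hw => CUR.singularValues_mul_norm_le_of_mem_range_conjTranspose A hw)
    (LinearMap.singularValues_nonneg _ _) hδ hε (CUR.le_one_of_lt_inv_condNumber hεκ)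
    (CUR.stableRank_pos hA)
    (by rw [CUR.frobNorm_conjTranspose]; exact CUR.sq_mul_frobNorm_sq_le hA hε hεκ) hd₁
  rw [CUR.minColRatio_conjTranspose, ← Matrix.conjTranspose_add, CUR.colLaw_conjTranspose] at hI
  -- The first coordinate of the product law carries the rows, hence the factor with `β`. Success
  -- contains the rectangle of the two spanning events, whose probability is the product.
  rw [mul_comm, CUR.samplingLaw]
  refine (mul_le_mul hI hJ (le_max_left _ _) MeasureTheory.measureReal_nonneg).trans ?_
  rw [← MeasureTheory.measureReal_prod_prod]
  exact MeasureTheory.measureReal_mono fun ω hω => CUR.sampleSucceeds_of_span_eq hω.1 hω.2
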